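/- Let $R$ be a complete, separated topological associative ring with unit, in which the open right ideals form a base of neighborhoods of zero. For a set $X$, let $R[[X]]$ be the set of all formal linear combinations $\sum_{x\in X} r_x x$ whose coefficients $r_x\in R$ form a family converging to zero (every neighborhood of zero in $R$ contains all but finitely many of the $r_x$). The functor $X\mapsto R[[X]]$ is a monad on the category of sets, with unit $x_0\mapsto 1\cdot x_0$ and with multiplication $R[[R[[X]]]]\to R[[X]]$ opening the parentheses: $\sum_s r_s s\mapsto\sum_x\bigl(\sum_s r_s s_x\bigr)x$, where $s=\sum_x s_x x$. A left $R$-contramodule is an algebra over this monad; these algebras form the category of left $R$-contramodules. Regard $R=R[[\{*\}]]$ as the free left $R$-contramodule with one generator. Let $a_1,a_2,a_3,\dots$ be a sequence of elements of $R$, and let $$B=\varinjlim\bigl(R\xrightarrow{\,*a_1\,}R\xrightarrow{\,*a_2\,}R\xrightarrow{\,*a_3\,}\cdots\bigr)$$ be the associated Bass flat left $R$-contramodule, that is, the direct limit, in the category of left $R$-contramodules, of the sequence of right multiplication maps $r\mapsto ra_n$. Proposition. If $B$ is a projective object of the category of left $R$-contramodules, then for every open right ideal $I\subset R$ the descending chain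 of right ideals $$R\supset a_1R+I\supset a_1a_2R+I\supset a_1a_2a_3R+I\supset\cdots$$ terminates: there is an $m\ge 0$ such that $a_1\cdots a_nR+I=a_1\cdots a_mR+I$ for all $n\ge m$. -/

import Mathlib

open CategoryTheory CategoryTheory.Limits Filter Topology

universe u

set_option linter.unusedSectionVars false

/-- The set `R[[X]]` of all formal linear combinations `∑ r_x x` of elements of `X` whose
coefficients form an `X`-indexed family converging to zero in the topology of `R`. -/
def ConvFam (R : Type*) [Zero R] [TopologicalSpace R] (X : Type*) : Type _ :=
  {r : X → R // Tendsto r cofinite (𝓝 0)}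

namespace ConvFam

section Sums

variable {R : Type*} [Ring R] [UniformSpace R] [IsUniformAddGroup R] [IsTopologicalRing R]
  [IsLinearTopology Rᵐᵒᵖ R]

/-- Convergence to zero may be tested on open right ideals. -/
theorem tendsto_iff {X : Type*} (g : X → R) :
    Tendsto g cofinite (𝓝 0) ↔
      ∀ I : Submodule Rᵐᵒᵖ R, IsOpen (I : Set R) → {x | g x ∉ I}.Finite := by
  rw [(IsLinearTopology.hasBasis_open_submodule (M := R) Rᵐᵒᵖ).tendsto_right_iff]
  simp only [Filter.eventually_cofinite, SetLike.mem_coe]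

theorem tendsto_mul {X : Type*} {g : X → R} (hg : Tendsto g cofinite (𝓝 0)) (φ : X → R) :
    Tendsto (fun x => g x * φ x) cofinite (𝓝 0) := by
  rw [tendsto_iff] at hg ⊢
  refine fun I hI => (hg I hI).subset fun x hx hgx => hx ?_
  exact I.smul_mem (MulOpposite.op (φ x)) hgx

theorem tsum_mem {X : Type*} (I : Submodule Rᵐᵒᵖ R) (hI : IsOpen (I : Set R)) {g : X → R}
    (hg : ∀ x, g x ∈ I) : ∑' x, g x ∈ I := by
  have hc : IsClosed (I : Set R) := I.toAddSubgroup.isClosed_of_isOpen hI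
  by_cases hs : Summable g
  · exact hc.mem_of_tendsto hs.hasSum
      (Eventually.of_forall fun s => I.sum_mem fun x _ => hg x)
  · rw [tsum_eq_zero_of_not_summable hs]
    exact I.zero_mem

theorem tendsto_tsum {Y : Type*} {β : Y → Type*} {g : (Σ y, β y) → R}
    (hg : Tendsto g cofinite (𝓝 0)) :
    Tendsto (fun y => ∑' z, g ⟨y, z⟩) cofinite (𝓝 0) := by
  rw [tendsto_iff] at hg ⊢
  intro I hI
  refine ((hg I hI).image Sigma.fst).subset fun y hy => ?_
  by_contra hcon
  refine hy (tsum_mem I hI fun z => ?_)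
  by_contra hz
  exact hcon ⟨⟨y, z⟩, hz, rfl⟩

/-- The doubly indexed family arising when parentheses are opened converges to zero. -/
theorem tendsto_double {S X : Type*} {r : S → R} (hr : Tendsto r cofinite (𝓝 0))
    {c : S → X → R} (hc : ∀ s, Tendsto (c s) cofinite (𝓝 0)) :
    Tendsto (fun p : S × X => r p.1 * c p.1 p.2) cofinite (𝓝 0) := by
  rw [tendsto_iff] at hr ⊢
  intro I hI
  have h : ∀ s, {x | r s * c s x ∉ I}.Finite := by
    intro s
    have : Tendsto (fun x => r s * c s x) cofinite (𝓝 0) := by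
      simpa using (hc s).const_mul (r s)
    exact (tendsto_iff _).1 this I hI
  refine ((hr I hI).biUnion fun s _ => (h s).image (Prod.mk s)).subset ?_
  rintro ⟨s, x⟩ hp
  simp only [Set.mem_iUnion]
  refine ⟨s, fun hs => hp ?_, x, hp, rfl⟩
  exact I.smul_mem (MulOpposite.op (c s x)) hs

variable [CompleteSpace R] [T2Space R]

theorem summable_of_tendsto {X : Type*} {g : X → R} (hg : Tendsto g cofinite (𝓝 0)) :
    Summable g := by
  have : NonarchimedeanAddGroup R :=
    { is_nonarchimedean := fun U hU => by
        obtain ⟨I, hI, hIU⟩ :=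
          (IsLinearTopology.hasBasis_open_submodule (M := R) Rᵐᵒᵖ).mem_iff.1 hU
        exact ⟨⟨I.toAddSubgroup, hI⟩, hIU⟩ }
  exact NonarchimedeanAddGroup.summable_of_tendsto_cofinite_zero hg


/-- The pairing `∑ r_x φ(x)` of a convergent family with an arbitrary function. -/
noncomputable def pair {X : Type*} (r : ConvFam R X) (φ : X → R) : R := ∑' x, r.1 x * φ x

open Classical in
/-- The "point measure" `1 · x₀`. -/
noncomputable def point (R : Type*) [Ring R] [TopologicalSpace R] {X : Type*} (x₀ : X) :
    ConvFam R X :=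
  ⟨Pi.single x₀ 1, by
    refine tendsto_nhds_of_eventually_eq ?_
    rw [Filter.eventually_cofinite]
    refine (Set.finite_singleton x₀).subset fun x hx => ?_
    by_contra h
    exact hx (Pi.single_eq_of_ne h _)⟩

/-- The map `R[[f]] : R[[X]] → R[[Y]]`, sending `∑ r_x x` to `∑_y (∑_{f x = y} r_x) y`. -/
noncomputable def map {X Y : Type*} (f : X → Y) (r : ConvFam R X) : ConvFam R Y :=
  ⟨fun y => ∑' x : {x // f x = y}, r.1 x,
    tendsto_tsum (g := fun p : Σ y, {x // f x = y} => r.1 p.2)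
      (r.2.comp (Equiv.sigmaFiberEquiv f).injective.tendsto_cofinite)⟩

/-- The "opening of parentheses" map `R[[R[[X]]]] → R[[X]]`: the coefficient of the image of
`∑_s r_s s` at `x` is `∑_s r_s s_x`, where `s = ∑_x s_x x`. -/
noncomputable def join {X : Type*} (r : ConvFam R (ConvFam R X)) : ConvFam R X :=
  ⟨fun x => ∑' s : ConvFam R X, r.1 s * s.1 x,
    tendsto_tsum (g := fun p : Σ _ : X, ConvFam R X => r.1 p.2 * p.2.1 p.1)
      ((tendsto_double r.2 (c := fun s x => s.1 x) fun s => s.2).comp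
        (((Equiv.sigmaEquivProd _ _).trans (Equiv.prodComm _ _)).injective.tendsto_cofinite))⟩

theorem tsum_sigma_of_tendsto {Y : Type*} {β : Y → Type*} {g : (Σ y, β y) → R}
    (hg : Tendsto g cofinite (𝓝 0)) : ∑' y, ∑' z, g ⟨y, z⟩ = ∑' p, g p :=
  (summable_of_tendsto hg).tsum_sigma.symm

theorem pair_map {X Y : Type*} (f : X → Y) (r : ConvFam R X) (φ : Y → R) :
    pair (map f r) φ = pair r (φ ∘ f) := by
  have h1 : Tendsto (fun x => r.1 x * φ (f x)) cofinite (𝓝 0) := tendsto_mul r.2 _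
  have h2 : Tendsto (fun p : Σ y, {x // f x = y} => r.1 p.2 * φ (f p.2)) cofinite (𝓝 0) :=
    h1.comp (Equiv.sigmaFiberEquiv f).injective.tendsto_cofinite
  have h3 := (Equiv.sigmaFiberEquiv f).tsum_eq (fun x => r.1 x * φ (f x))
  have h4 := tsum_sigma_of_tendsto h2
  unfold pair
  simp only [Function.comp_apply]
  rw [← h3]
  refine Eq.trans ?_ h4
  refine tsum_congr fun y => ?_
  have hr : Summable fun x : {x // f x = y} => r.1 x :=
    summable_of_tendsto (r.2.comp Subtype.val_injective.tendsto_cofinite)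
  refine (hr.tsum_mul_right (φ y)).symm.trans (tsum_congr fun x => ?_)
  rw [x.2]

theorem pair_join {X : Type*} (r : ConvFam R (ConvFam R X)) (φ : X → R) :
    pair (join r) φ = pair r fun s => pair s φ := by
  have h1 : Tendsto (fun p : ConvFam R X × X => r.1 p.1 * (p.1.1 p.2 * φ p.2)) cofinite (𝓝 0) :=
    tendsto_double r.2 (c := fun s x => s.1 x * φ x) fun s => tendsto_mul s.2 φ
  have h2 : ∀ x, Summable fun s : ConvFam R X => r.1 s * s.1 x := fun x =>
    summable_of_tendsto (tendsto_mul r.2 fun s => s.1 x)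
  have h3 : ∀ s : ConvFam R X, Summable fun x => s.1 x * φ x := fun s =>
    summable_of_tendsto (tendsto_mul s.2 φ)
  have h4 := (summable_of_tendsto h1).tsum_comm (f := fun s x => r.1 s * (s.1 x * φ x))
  unfold pair
  calc ∑' x, (join r).1 x * φ x = ∑' x, ∑' s : ConvFam R X, r.1 s * (s.1 x * φ x) := by
        refine tsum_congr fun x => ?_
        refine ((h2 x).tsum_mul_right (φ x)).symm.trans (tsum_congr fun s => ?_)
        rw [mul_assoc]
    _ = ∑' s : ConvFam R X, ∑' x, r.1 s * (s.1 x * φ x) := h4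
    _ = _ := tsum_congr fun s => (h3 s).tsum_mul_left (r.1 s)

open Classical in
theorem map_apply {X Y : Type*} (f : X → Y) (r : ConvFam R X) (y : Y) :
    (map f r).1 y = pair r fun x => if f x = y then 1 else 0 := by
  unfold pair map
  refine (tsum_subtype {x | f x = y} r.1).trans (tsum_congr fun x => ?_)
  by_cases h : f x = y <;> simp [Set.indicator, h]

theorem join_apply {X : Type*} (r : ConvFam R (ConvFam R X)) (x : X) :
    (join r).1 x = pair r fun s => s.1 x := rfl

theorem pair_point {X : Type*} (x : X) (φ : X → R) : pair (point R x) φ = φ x := by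
  classical
  unfold pair point
  rw [tsum_eq_single x fun y hy => by simp [Pi.single_eq_of_ne hy]]
  simp

open Classical in
theorem point_apply {X : Type*} (x y : X) :
    (point R x).1 y = if x = y then 1 else 0 := by
  simp [point, Pi.single_apply, eq_comm]

theorem join_map {X Y : Type*} (f : X → ConvFam R Y) (r : ConvFam R X) (y : Y) :
    (join (map f r)).1 y = pair r fun s => (f s).1 y := by
  rw [join_apply, pair_map]
  rfl

/-- Multiplication of all coefficients by `a` on the right. -/
def mulRight (a : R) {X : Type*} (r : ConvFam R X) : ConvFam R X :=
  ⟨fun x => r.1 x * a, tendsto_mul r.2 fun _ => a⟩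

theorem join_map_mulRight (a : R) {X : Type*} (r : ConvFam R (ConvFam R X)) :
    join (map (mulRight a) r) = mulRight a (join r) := by
  refine Subtype.ext (funext fun x => ?_)
  have h2 : Summable fun s : ConvFam R X => r.1 s * s.1 x :=
    summable_of_tendsto (tendsto_mul r.2 fun s => s.1 x)
  refine (join_map _ _ _).trans (Eq.trans (tsum_congr fun s => ?_) (h2.tsum_mul_right a))
  exact (mul_assoc _ _ _).symm

open Classical in
theorem pair_indicator {X : Type*} (r : ConvFam R X) (y : X) :
    (pair r fun x => if x = y then 1 else 0) = r.1 y := by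
  unfold pair
  rw [tsum_eq_single y fun x hx => by simp [hx]]
  simp

theorem map_id {X : Type*} (r : ConvFam R X) : map (fun x => x) r = r := by
  classical
  exact Subtype.ext (funext fun y => (map_apply _ _ _).trans (pair_indicator r y))

theorem map_map {X Y Z : Type*} (f : X → Y) (g : Y → Z) (r : ConvFam R X) :
    map (fun x => g (f x)) r = map g (map f r) := by
  refine Subtype.ext (funext fun z => ?_)
  rw [map_apply, map_apply g, pair_map]
  rfl

theorem point_naturality {X Y : Type*} (f : X → Y) (x : X) :
    point R (f x) = map f (point R x) := by
  refine Subtype.ext (funext fun y => ?_)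
  rw [map_apply, pair_point, point_apply]

theorem join_naturality {X Y : Type*} (f : X → Y) (r : ConvFam R (ConvFam R X)) :
    join (map (map f) r) = map f (join r) := by
  refine Subtype.ext (funext fun y => ?_)
  rw [join_map, map_apply, pair_join]
  congr 1
  funext s
  exact map_apply _ _ _

theorem join_assoc {X : Type*} (r : ConvFam R (ConvFam R (ConvFam R X))) :
    join (map join r) = join (join r) := by
  refine Subtype.ext (funext fun y => ?_)
  rw [join_map, join_apply (join r), pair_join]
  rfl

theorem join_point {X : Type*} (r : ConvFam R X) : join (point R r) = r := by
  refine Subtype.ext (funext fun y => ?_)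
  rw [join_apply, pair_point]

theorem join_map_point {X : Type*} (r : ConvFam R X) : join (map (point R) r) = r := by
  refine Subtype.ext (funext fun y => ?_)
  rw [join_map]
  refine Eq.trans ?_ (pair_indicator r y)
  congr 1
  funext x
  exact point_apply _ _

end Sums
end ConvFam

section Colimits

variable {T : Monad (Type u)} {J : Type} [Category.{0} J] (F : J ⥤ T.Algebra)

namespace AlgebraColimit

/-- The disjoint union of the underlying sets of a diagram of algebras. -/
abbrev Gen : Type u := Σ j, (F.obj j).A

/-- The map from the free algebra on the disjoint union to the vertex of a cocone. -/
def toPt (c : Cocone F) : T.obj (Gen F) ⟶ c.pt.A :=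
  T.map (TypeCat.ofHom fun x : Gen F => (c.ι.app x.1).f x.2) ≫ c.pt.a

/-- Two elements of the free algebra are identified if they are so in every cocone. -/
def rel : Setoid (T.obj (Gen F)) where
  r x y := ∀ c : Cocone F, toPt F c x = toPt F c y
  iseqv := ⟨fun _ _ => rfl, fun h c => (h c).symm, fun h h' c => (h c).trans (h' c)⟩

/-- The underlying set of the colimit. -/
abbrev Carrier : Type u := Quotient (rel F)

/-- The projection from the free algebra. -/
def proj : T.obj (Gen F) ⟶ Carrier F := TypeCat.ofHom (Quotient.mk (rel F))

/-- The induced map to the vertex of a cocone. -/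
def descFun (c : Cocone F) : Carrier F ⟶ c.pt.A :=
  TypeCat.ofHom (Quotient.lift (toPt F c) fun _ _ h => h c)

theorem proj_desc (c : Cocone F) : proj F ≫ descFun F c = toPt F c := rfl

theorem mu_toPt (c : Cocone F) :
    T.μ.app (Gen F) ≫ toPt F c = T.map (toPt F c) ≫ c.pt.a := by
  unfold toPt
  rw [← Category.assoc, ← T.μ.naturality, Category.assoc, c.pt.assoc]
  simp

theorem desc_jointly {X : Type u} {f g : X ⟶ Carrier F}
    (h : ∀ c, f ≫ descFun F c = g ≫ descFun F c) : f = g := by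
  ext x : 3
  obtain ⟨a, ha⟩ := Quotient.exists_rep (f x)
  obtain ⟨b, hb⟩ := Quotient.exists_rep (g x)
  refine ha.symm.trans (Eq.trans (Quotient.sound fun c => ?_) hb)
  have := ConcreteCategory.congr_hom (h c) x
  change descFun F c (f x) = descFun F c (g x) at this
  rw [← ha, ← hb] at this
  exact this

/-- A set-theoretic section of the projection. -/
noncomputable def sec : Carrier F ⟶ T.obj (Gen F) := TypeCat.ofHom Quotient.out

theorem sec_proj : sec F ≫ proj F = 𝟙 _ := by
  ext x : 3
  exact Quotient.out_eq x

/-- The structure map of the colimit. -/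
noncomputable def act : T.obj (Carrier F) ⟶ Carrier F :=
  T.map (sec F) ≫ T.μ.app (Gen F) ≫ proj F

theorem sec_toPt (c : Cocone F) : sec F ≫ toPt F c = descFun F c := by
  rw [← proj_desc, ← Category.assoc, sec_proj, Category.id_comp]

theorem act_desc (c : Cocone F) : act F ≫ descFun F c = T.map (descFun F c) ≫ c.pt.a := by
  unfold act
  rw [Category.assoc, Category.assoc, proj_desc, mu_toPt, ← Category.assoc, ← T.map_comp,
    sec_toPt]

/-- The colimit algebra. -/
noncomputable def alg : T.Algebra where
  A := Carrier F
  a := act F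
  unit := by
    refine desc_jointly F fun c => ?_
    rw [Category.assoc, act_desc, ← Category.assoc, ← T.η.naturality, Category.assoc, c.pt.unit]
    simp
  assoc := by
    refine desc_jointly F fun c => ?_
    rw [Category.assoc, Category.assoc, act_desc, ← Category.assoc, ← Category.assoc,
      ← T.μ.naturality, ← T.map_comp, act_desc, Category.assoc, c.pt.assoc]
    simp

/-- The maps of the colimit cocone. -/
noncomputable def inc (j : J) : (F.obj j).A ⟶ Carrier F :=
  TypeCat.ofHom (fun x => (⟨j, x⟩ : Gen F)) ≫ T.η.app (Gen F) ≫ proj F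

theorem inc_desc (j : J) (c : Cocone F) : inc F j ≫ descFun F c = (c.ι.app j).f := by
  unfold inc
  rw [Category.assoc, Category.assoc, proj_desc]
  unfold toPt
  rw [← Category.assoc (T.η.app _), ← T.η.naturality, Category.assoc, c.pt.unit]
  rfl

theorem inc_hom (j : J) : T.map (inc F j) ≫ act F = (F.obj j).a ≫ inc F j := by
  refine desc_jointly F fun c => ?_
  rw [Category.assoc, act_desc, ← Category.assoc, ← T.map_comp, inc_desc,
    Category.assoc, inc_desc]
  exact (c.ι.app j).h

theorem inc_naturality {i j : J} (f : i ⟶ j) : (F.map f).f ≫ inc F j = inc F i := by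
  refine desc_jointly F fun c => ?_
  rw [Category.assoc, inc_desc, inc_desc]
  exact congrArg Monad.Algebra.Hom.f (c.w f)

/-- The maps `inc F j` together. -/
noncomputable def genInc : Gen F ⟶ Carrier F := TypeCat.ofHom fun x => inc F x.1 x.2

theorem genInc_desc (c : Cocone F) : genInc F ≫ descFun F c =
    TypeCat.ofHom fun x : Gen F => (c.ι.app x.1).f x.2 := by
  ext x : 3
  exact ConcreteCategory.congr_hom (inc_desc F x.1 c) x.2

theorem proj_eq : proj F = T.map (genInc F) ≫ act F := by
  refine desc_jointly F fun c => ?_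
  rw [Category.assoc, act_desc, ← Category.assoc, ← T.map_comp, genInc_desc, proj_desc]
  rfl

theorem desc_unique (c : Cocone F) (m : Carrier F ⟶ c.pt.A)
    (h : T.map m ≫ c.pt.a = act F ≫ m) (hm : ∀ j, inc F j ≫ m = (c.ι.app j).f) :
    m = descFun F c := by
  have hg : genInc F ≫ m = TypeCat.ofHom fun x : Gen F => (c.ι.app x.1).f x.2 := by
    ext x : 3
    exact ConcreteCategory.congr_hom (hm x.1) x.2
  have key : proj F ≫ m = toPt F c := by
    rw [proj_eq, Category.assoc, ← h, ← Category.assoc, ← T.map_comp, hg]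
    rfl
  rw [← sec_toPt, ← key, ← Category.assoc, sec_proj, Category.id_comp]

/-- The colimit cocone. -/
noncomputable def cocone : Cocone F where
  pt := alg F
  ι :=
    { app := fun j => { f := inc F j, h := inc_hom F j }
      naturality := fun _ _ f => Monad.Algebra.Hom.ext (inc_naturality F f) }

/-- The universal property of the colimit cocone. -/
noncomputable def isColimit : IsColimit (cocone F) where
  desc c := { f := descFun F c, h := (act_desc F c).symm }
  fac c j := Monad.Algebra.Hom.ext (inc_desc F j c)
  uniq c m hm := Monad.Algebra.Hom.ext <|
    desc_unique F c m.f m.h fun j => congrArg Monad.Algebra.Hom.f (hm j)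

end AlgebraColimit

theorem hasColimit_algebra : HasColimit F :=
  ⟨⟨⟨AlgebraColimit.cocone F, AlgebraColimit.isColimit F⟩⟩⟩

end Colimits

section Contramodules

variable (R : Type u) [Ring R] [UniformSpace R] [IsUniformAddGroup R] [IsTopologicalRing R]
  [CompleteSpace R] [T2Space R] [IsLinearTopology Rᵐᵒᵖ R]

open ConvFam

/-- The monad `X ↦ R[[X]]` on the category of sets. -/
noncomputable def contraMonad : Monad (Type u) where
  obj X := ConvFam R X
  map f := TypeCat.ofHom (ConvFam.map f)
  map_id X := by ext r : 3; exact ConvFam.map_id (R := R) r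
  map_comp f g := by ext r : 3; exact ConvFam.map_map (R := R) f g r
  η :=
    { app := fun X => TypeCat.ofHom (point R)
      naturality := fun X Y f => by ext x : 3; exact point_naturality (R := R) f x }
  μ :=
    { app := fun X => TypeCat.ofHom join
      naturality := fun X Y f => by ext r : 3; exact join_naturality (R := R) f r }
  assoc X := by ext r : 3; exact join_assoc (R := R) r
  left_unit X := by ext r : 3; exact join_point (R := R) r
  right_unit X := by ext r : 3; exact join_map_point (R := R) r

/-- The category `R-contra` of left `R`-contramodules: algebras over the monad `X ↦ R[[X]]`. -/
abbrev Contramodule : Type (u + 1) := (contraMonad R).Algebra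

/-- `R` viewed as the free left `R`-contramodule with one generator. -/
noncomputable abbrev freeOne : Contramodule R := (contraMonad R).free.obj PUnit.{u + 1}

variable {R}

/-- Right multiplication by `a`, a contramodule endomorphism of `R`. -/
noncomputable def rightMul (a : R) : freeOne R ⟶ freeOne R where
  f := TypeCat.ofHom (mulRight a : ConvFam R PUnit.{u + 1} → ConvFam R PUnit.{u + 1})
  h := by
    ext r : 3
    exact join_map_mulRight a r

/-- The sequence `R → R → R → ⋯` of right multiplications by `a 0, a 1, a 2, …`. -/
noncomputable def bassDiagram (a : ℕ → R) : ℕ ⥤ Contramodule R :=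
  Functor.ofSequence (X := fun _ => freeOne R) fun n => rightMul (a n)

instance (a : ℕ → R) : HasColimit (bassDiagram a) := hasColimit_algebra _

/-- The Bass flat left `R`-contramodule of the sequence `a`, the direct limit in `R-contra`. -/
noncomputable def bassFlat (a : ℕ → R) : Contramodule R := colimit (bassDiagram a)

end Contramodules

/-- The right ideal `a₀a₁⋯aₙ₋₁R + I`; for `n = 0` the product is empty and this is `R`. -/
def bassChain {R : Type*} [Ring R] (a : ℕ → R) (I : Submodule Rᵐᵒᵖ R) (n : ℕ) :
    Submodule Rᵐᵒᵖ R :=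
  Submodule.span Rᵐᵒᵖ {((List.range n).map a).prod} ⊔ I

/-! ### Pairings and the telescope relation on `R[[ℕ]]` -/

namespace ConvFam

section Pairing

variable {R : Type*} [Ring R] [UniformSpace R] [IsUniformAddGroup R] [IsTopologicalRing R]
  [IsLinearTopology Rᵐᵒᵖ R] [CompleteSpace R] [T2Space R]

/-! Let `xₙ` be the free generators of `R[[ℕ]]`, and let `C` be the cokernel of the telescope map
`xₙ ↦ xₙ - aₙ xₙ₊₁`. Sending `xₙ` to the image of `1` from stage `n` gives an epimorphism `R[[ℕ]] →
B`, and `C` is the vertex of a cocone, so there is a map `B → C`; the composite is the projection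
`R[[ℕ]] → C`. Nothing more is needed about how `B` and `C` compare.

A section of `R[[ℕ]] → B` sends the images of the `xₙ` to elements `bₙ` with `bₙ = aₙ bₙ₊₁`, and `x₀
- b₀` dies in `C`, hence is the telescope of some `y` in `R[[ℕ]]` (`exists_splitting`). Write `Pₙ`
for the product of the first `n` terms of the sequence. The first relation puts every coefficient of
`b₀` in `Pₖ R`, for every `k`. The second is a recursion for the coefficients of `y` which makes
`yₙ` agree with `Pₙ` modulo `Pₖ R + I`, for all `n` and `k`. Since `y` converges to zero, `yₙ` lies
in `I` for some `n`; for this one `n`, `Pₙ` lies in `Pₖ R + I` for every `k`, so the chain is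
constant from `n` on. -/

theorem pair_sub {X : Type*} (r : ConvFam R X) (φ ψ : X → R) :
    pair r (fun x => φ x - ψ x) = pair r φ - pair r ψ := by
  unfold pair
  simp only [mul_sub]
  exact (summable_of_tendsto (tendsto_mul r.2 φ)).tsum_sub
    (summable_of_tendsto (tendsto_mul r.2 ψ))

theorem pair_mul {X : Type*} (r : ConvFam R X) (φ : X → R) (c : R) :
    pair r (fun x => φ x * c) = pair r φ * c := by
  unfold pair
  simp only [← mul_assoc]
  exact (summable_of_tendsto (tendsto_mul r.2 φ)).tsum_mul_right c

theorem pair_unique {X : Type*} [Unique X] (r : ConvFam R X) (φ : X → R) :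
    pair r φ = r.1 default * φ default := by
  unfold pair
  exact tsum_eq_single default fun x hx => absurd (Subsingleton.elim x default) hx

/-- The `j`-th coefficient of `∑ yₙ (xₙ - aₙ xₙ₊₁)`. -/
def telescope {R : Type*} [Ring R] (a : ℕ → R) (y : ULift ℕ → R) : ℕ → R
  | 0 => y ⟨0⟩
  | n + 1 => y ⟨n + 1⟩ - y ⟨n⟩ * a n

theorem telescope_zero (a : ℕ → R) (j : ℕ) : telescope a (fun _ => 0) j = 0 := by
  cases j <;> simp [telescope]

theorem telescope_neg (a : ℕ → R) (y : ULift ℕ → R) (j : ℕ) :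
    telescope a (fun x => -y x) j = -telescope a y j := by
  cases j
  · rfl
  · simp only [telescope]; noncomm_ring

theorem telescope_add (a : ℕ → R) (y z : ULift ℕ → R) (j : ℕ) :
    telescope a (fun x => y x + z x) j = telescope a y j + telescope a z j := by
  cases j
  · rfl
  · simp only [telescope]; noncomm_ring

theorem pair_telescope (a : ℕ → R) {X : Type*} (r : ConvFam R X) (h : X → ULift ℕ → R) (j : ℕ) :
    pair r (fun x => telescope a (h x) j) = telescope a (fun i => pair r fun x => h x i) j := by
  cases j
  · rfl
  · simp only [telescope]
    rw [pair_sub, pair_mul]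

/-- Two elements of `R[[ℕ]]` are identified if they differ by some `∑ yₙ (xₙ - aₙ xₙ₊₁)`. -/
def telescopeSetoid.{v} (a : ℕ → R) : Setoid (ConvFam R (ULift.{v} ℕ)) where
  r p q := ∃ y : ConvFam R (ULift.{v} ℕ), ∀ j : ℕ, p.1 ⟨j⟩ - q.1 ⟨j⟩ = telescope a y.1 j
  iseqv :=
    { refl := fun _ => ⟨⟨fun _ => 0, tendsto_const_nhds⟩, fun j => by
        rw [telescope_zero, sub_self]⟩
      symm := fun ⟨y, hy⟩ => ⟨⟨fun x => -y.1 x, by simpa using y.2.neg⟩, fun j => by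
        rw [telescope_neg, ← hy, neg_sub]⟩
      trans := fun ⟨y, hy⟩ ⟨z, hz⟩ =>
        ⟨⟨fun x => y.1 x + z.1 x, by simpa using y.2.add z.2⟩, fun j => by
          rw [telescope_add, ← hy, ← hz, sub_add_sub_cancel]⟩ }

/-- The relation is compatible with infinite combinations, which is what lets the monad act on the
quotient. Chosen witnesses `h w` for the individual `w` are combined with the same coefficients,
since pairing commutes with `telescope`. -/
theorem join_map_telescope.{v} (a : ℕ → R) (g : ConvFam R (ULift.{v} ℕ) → ConvFam R (ULift.{v} ℕ))
    (hg : ∀ w, telescopeSetoid.{_, v} a w (g w)) (r : ConvFam R (ConvFam R (ULift.{v} ℕ))) :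
    telescopeSetoid a (join r) (join (map g r)) := by
  choose h hh using hg
  refine ⟨join (map h r), fun j => ?_⟩
  rw [join_map, join_apply, ← pair_sub]
  simp only [hh, pair_telescope]
  congr 1
  exact funext fun i => (join_map h r i).symm

end Pairing
end ConvFam

/-! ### Homomorphisms out of free contramodules -/

section Contramodules

variable {R : Type u} [Ring R] [UniformSpace R] [IsUniformAddGroup R] [IsTopologicalRing R]
  [CompleteSpace R] [T2Space R] [IsLinearTopology Rᵐᵒᵖ R]

open ConvFam

theorem Contramodule.free_hom_ext {X : Type u} {A : Contramodule R}
    {f g : (contraMonad R).free.obj X ⟶ A}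
    (h : ∀ x : X, f.f (point R x : ConvFam R X) = g.f (point R x : ConvFam R X)) : f = g := by
  refine ((contraMonad R).adj.homEquiv X A).injective ?_
  rw [Adjunction.homEquiv_unit, Adjunction.homEquiv_unit]
  ext x : 3
  exact h x

/-- A homomorphism between free contramodules is determined by its values on the generators. -/
theorem Contramodule.free_hom_apply {X Y : Type u}
    (f : (contraMonad R).free.obj X ⟶ (contraMonad R).free.obj Y) (r : ConvFam R X) (y : Y) :
    (f.f r : ConvFam R Y).1 y = pair r fun x => (f.f (point R x : ConvFam R X) : ConvFam R Y).1 y := by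
  -- Every `r` is obtained by opening the parentheses in the combination of its generators; `f`
  -- commutes with this operation.
  have h := ConcreteCategory.congr_hom f.h (ConvFam.map (point R) r : ConvFam R (ConvFam R X))
  let g : ConvFam R X → ConvFam R Y := fun s => f.f s
  have h' : join (ConvFam.map g (ConvFam.map (point R) r))
      = g (join (ConvFam.map (point R) r)) := h
  rw [join_map_point] at h'
  change (g r).1 y = pair r fun x => (g (point R x)).1 y
  rw [← h', join_map, pair_map]
  rfl

/-! ### The cokernel of the telescope map -/

/-- The underlying set of the cokernel of the telescope map. -/
abbrev TelescopeQuot (a : ℕ → R) : Type u := Quotient (telescopeSetoid.{u, u} a)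

/-- The structure map of the cokernel of the telescope map. -/
noncomputable def telescopeAct (a : ℕ → R) (r : ConvFam R (TelescopeQuot a)) : TelescopeQuot a :=
  Quotient.mk _ (join (ConvFam.map Quotient.out r))

/-- Independence of the choice of representatives: `Quotient.out` may be replaced by any lift. -/
theorem telescopeAct_map (a : ℕ → R) (r : ConvFam R (ConvFam R (ULift.{u} ℕ))) :
    telescopeAct a (ConvFam.map (Quotient.mk (telescopeSetoid a)) r)
      = Quotient.mk (telescopeSetoid a) (join r) := by
  unfold telescopeAct
  rw [← ConvFam.map_map]
  exact Quotient.sound ((telescopeSetoid a).symm (join_map_telescope a _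
    (fun v => (telescopeSetoid a).symm (Quotient.mk_out v)) r))

theorem telescopeAct_join (a : ℕ → R) (r : ConvFam R (ConvFam R (TelescopeQuot a))) :
    telescopeAct a (join r) = telescopeAct a (ConvFam.map (telescopeAct a) r) := by
  -- Lifting `r` to the free level through representatives reduces the claim to associativity of
  -- `join`.
  obtain ⟨q, rfl⟩ : ∃ q, ConvFam.map (ConvFam.map (Quotient.mk (telescopeSetoid a))) q = r := by
    refine ⟨ConvFam.map (ConvFam.map Quotient.out) r, ?_⟩
    rw [← ConvFam.map_map]
    conv_rhs => rw [← ConvFam.map_id r]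
    congr 1
    funext s
    rw [← ConvFam.map_map]
    simp only [Quotient.out_eq]
    exact ConvFam.map_id s
  rw [join_naturality, telescopeAct_map, ← ConvFam.map_map]
  simp only [telescopeAct_map]
  rw [ConvFam.map_map ConvFam.join (Quotient.mk (telescopeSetoid a)), telescopeAct_map, join_assoc]

/-- The cokernel of the telescope map. -/
noncomputable def telescopeAlg (a : ℕ → R) : Contramodule R where
  A := TelescopeQuot a
  a := TypeCat.ofHom (telescopeAct a : ConvFam R (TelescopeQuot a) → TelescopeQuot a)
  unit := by
    ext x : 3
    change telescopeAct a (point R x) = x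
    obtain ⟨v, rfl⟩ := Quotient.exists_rep x
    rw [point_naturality, telescopeAct_map, join_point]
  assoc := by
    ext r : 3
    exact telescopeAct_join a r

/-- The projection from the free contramodule onto the cokernel of the telescope map. -/
noncomputable def telescopeProj (a : ℕ → R) :
    (contraMonad R).free.obj (ULift.{u} ℕ) ⟶ telescopeAlg a where
  f := TypeCat.ofHom (Quotient.mk (telescopeSetoid a) :
    ConvFam R (ULift.{u} ℕ) → TelescopeQuot a)
  h := by
    ext r : 3
    exact telescopeAct_map a r

/-- The inclusion of the `n`-th summand. -/
noncomputable def summand (R : Type u) [Ring R] [UniformSpace R] [IsUniformAddGroup R]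
    [IsTopologicalRing R] [CompleteSpace R] [T2Space R] [IsLinearTopology Rᵐᵒᵖ R] (n : ℕ) :
    freeOne R ⟶ (contraMonad R).free.obj (ULift.{u} ℕ) :=
  (contraMonad R).free.map (TypeCat.ofHom fun _ => ⟨n⟩)

theorem summand_point (n : ℕ) (x : PUnit.{u + 1}) :
    ((summand R n).f (point R x : ConvFam R PUnit.{u + 1}) : ConvFam R (ULift.{u} ℕ))
      = point R ⟨n⟩ :=
  (point_naturality (R := R) (fun _ : PUnit.{u + 1} => (⟨n⟩ : ULift.{u} ℕ)) x).symm

theorem rightMul_summand_proj (a : ℕ → R) (n : ℕ) :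
    rightMul (a n) ≫ summand R (n + 1) ≫ telescopeProj a = summand R n ≫ telescopeProj a := by
  refine Contramodule.free_hom_ext fun x => ?_
  change Quotient.mk (telescopeSetoid a)
      ((summand R (n + 1)).f (mulRight (a n) (point R x)) : ConvFam R (ULift.{u} ℕ))
    = Quotient.mk (telescopeSetoid a) ((summand R n).f (point R x : ConvFam R PUnit.{u + 1}))
  -- The element `xₙ - aₙ xₙ₊₁` is the telescope of the generator `xₙ`.
  refine Quotient.sound ((telescopeSetoid a).symm ⟨point R ⟨n⟩, fun j => ?_⟩)
  rw [summand_point n x, Contramodule.free_hom_apply (summand R (n + 1)), pair_unique,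
    summand_point]
  cases j with
  | zero => simp [telescope, mulRight, point_apply]
  | succ j =>
    simp only [telescope, mulRight, point_apply, ULift.up.injEq, Nat.add_right_cancel_iff]
    by_cases h : n = j <;> simp [h]

/-- The cokernel of the telescope map as a cocone over the Bass diagram. -/
noncomputable def telescopeCocone (a : ℕ → R) : Cocone (bassDiagram a) where
  pt := telescopeAlg a
  ι := NatTrans.ofSequence (fun n => summand R n ≫ telescopeProj a) fun n => by
    have h : (bassDiagram a).map (homOfLE (Nat.le_add_right n 1)) = rightMul (a n) :=
      Functor.ofSequence_map_homOfLE_succ _ n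
    rw [h]
    exact (rightMul_summand_proj a n).trans (Category.comp_id _).symm

/-- The map from the Bass contramodule to the cokernel of the telescope map. -/
noncomputable def bassDesc (a : ℕ → R) : bassFlat a ⟶ telescopeAlg a :=
  colimit.desc (bassDiagram a) (telescopeCocone a)

/-- The canonical map from `R` to the Bass contramodule at the `n`-th stage. -/
noncomputable def bassIncl (a : ℕ → R) (n : ℕ) : freeOne R ⟶ bassFlat a :=
  colimit.ι (bassDiagram a) n

theorem rightMul_bassIncl (a : ℕ → R) (n : ℕ) :
    rightMul (a n) ≫ bassIncl a (n + 1) = bassIncl a n := by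
  have h : (bassDiagram a).map (homOfLE (Nat.le_add_right n 1)) = rightMul (a n) :=
    Functor.ofSequence_map_homOfLE_succ _ n
  rw [← h]
  exact colimit.w (bassDiagram a) _

/-- The presentation of the Bass contramodule by the free contramodule on `ℕ`. -/
noncomputable def bassCover (a : ℕ → R) :
    (contraMonad R).free.obj (ULift.{u} ℕ) ⟶ bassFlat a :=
  ((contraMonad R).adj.homEquiv _ _).symm
    (TypeCat.ofHom fun n => (bassIncl a n.down).f (point R PUnit.unit : ConvFam R PUnit.{u + 1}))

theorem bassCover_point (a : ℕ → R) (n : ULift.{u} ℕ) :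
    (bassCover a).f (point R n : ConvFam R (ULift.{u} ℕ))
      = (bassIncl a n.down).f (point R PUnit.unit : ConvFam R PUnit.{u + 1}) := by
  have h := ((contraMonad R).adj.homEquiv (ULift.{u} ℕ) (bassFlat a)).apply_symm_apply
    (TypeCat.ofHom fun n => (bassIncl a n.down).f (point R PUnit.unit : ConvFam R PUnit.{u + 1}))
  rw [Adjunction.homEquiv_unit] at h
  exact ConcreteCategory.congr_hom h n

theorem summand_bassCover (a : ℕ → R) (n : ℕ) : summand R n ≫ bassCover a = bassIncl a n := by
  refine Contramodule.free_hom_ext fun x => ?_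
  refine Eq.trans ?_ (bassCover_point a ⟨n⟩)
  exact congrArg (bassCover a).f (summand_point n x)

/-- The colimit maps are jointly epic and all factor through the cover. -/
instance epi_bassCover (a : ℕ → R) : Epi (bassCover a) where
  left_cancellation g h hgh := by
    refine colimit.hom_ext fun n => ?_
    change bassIncl a n ≫ g = bassIncl a n ≫ h
    rw [← summand_bassCover, Category.assoc, Category.assoc, hgh]

theorem bassCover_desc (a : ℕ → R) :
    bassCover a ≫ bassDesc a = telescopeProj a := by
  refine Contramodule.free_hom_ext fun n => ?_
  have h : bassIncl a n.down ≫ bassDesc a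
      = summand R n.down ≫ telescopeProj a := colimit.ι_desc _ _
  refine (congrArg (bassDesc a).f
    (bassCover_point a n)).trans ?_
  refine (ConcreteCategory.congr_hom (congrArg Monad.Algebra.Hom.f h)
    (point R PUnit.unit : ConvFam R PUnit.{u + 1})).trans ?_
  exact congrArg (telescopeProj a).f (summand_point n.down PUnit.unit)

/-- If the Bass contramodule is projective, then the telescope presentation splits: there are
elements `bₙ` of `R[[ℕ]]` with `bₙ = aₙ bₙ₊₁` such that `x₀ - b₀` lies in the image of the
telescope map. -/
theorem exists_splitting (a : ℕ → R) (hB : Projective (bassFlat a)) :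
    ∃ b : ℕ → ConvFam R (ULift.{u} ℕ), (∀ n j, (b n).1 j = a n * (b (n + 1)).1 j) ∧
      telescopeSetoid a (point R ⟨0⟩) (b 0) := by
  obtain ⟨s, hs⟩ := hB.factors (𝟙 _) (bassCover a)
  refine ⟨fun n => (bassIncl a n ≫ s).f (point R PUnit.unit : ConvFam R PUnit.{u + 1}),
    fun n j => ?_, ?_⟩
  · have h : bassIncl a n ≫ s = rightMul (a n) ≫ bassIncl a (n + 1) ≫ s := by
      rw [← Category.assoc, rightMul_bassIncl]
    simp only [h]
    change ((bassIncl a (n + 1) ≫ s).f (mulRight (a n) (point R PUnit.unit)) :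
      ConvFam R (ULift.{u} ℕ)).1 j = _
    rw [Contramodule.free_hom_apply, pair_unique]
    congr 1
    simp [mulRight, point_apply]
  · have h : (bassIncl a 0 ≫ s) ≫ telescopeProj a = summand R 0 ≫ telescopeProj a := by
      -- The projection to the cokernel factors through the cover, so the section `s` cancels.
      rw [← bassCover_desc, Category.assoc, reassoc_of% hs, ← summand_bassCover, Category.assoc]
    have h' := ConcreteCategory.congr_hom (congrArg Monad.Algebra.Hom.f h)
      (point R PUnit.unit : ConvFam R PUnit.{u + 1})
    have h'' : Quotient.mk (telescopeSetoid a)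
        ((bassIncl a 0 ≫ s).f (point R PUnit.unit : ConvFam R PUnit.{u + 1}))
        = Quotient.mk (telescopeSetoid a)
          ((summand R 0).f (point R PUnit.unit : ConvFam R PUnit.{u + 1})) := h'
    rw [summand_point] at h''
    exact (telescopeSetoid a).symm (Quotient.exact h'')

end Contramodules

/-! ### Termination of the chain of right ideals -/

theorem prod_mem_bassChain {R : Type*} [Ring R] (a : ℕ → R) (I : Submodule Rᵐᵒᵖ R) (n : ℕ)
    (c : R) : ((List.range n).map a).prod * c ∈ bassChain a I n :=
  Submodule.mem_sup_left ((Submodule.span Rᵐᵒᵖ _).smul_mem (MulOpposite.op c)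
    (Submodule.mem_span_singleton_self _))

theorem bassChain_antitone {R : Type*} [Ring R] (a : ℕ → R) (I : Submodule Rᵐᵒᵖ R) :
    Antitone (bassChain a I) := by
  refine antitone_nat_of_succ_le fun n => sup_le ?_ le_sup_right
  rw [Submodule.span_singleton_le_iff_mem, List.prod_range_succ]
  exact prod_mem_bassChain a I n _

theorem proposition4p3 {R : Type u} [Ring R] [UniformSpace R] [IsUniformAddGroup R]
    [IsTopologicalRing R] [CompleteSpace R] [T2Space R] [IsLinearTopology Rᵐᵒᵖ R]
    (a : ℕ → R) (hB : Projective (bassFlat a))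
    (I : Submodule Rᵐᵒᵖ R) (hI : IsOpen (I : Set R)) :
    ∃ m, ∀ n, m ≤ n → bassChain a I n = bassChain a I m := by
  obtain ⟨b, hb, y, hy⟩ := exists_splitting a hB
  have hprod : ∀ k j, (b 0).1 j = ((List.range k).map a).prod * (b k).1 j := by
    intro k j
    induction k with
    | zero => simp
    | succ k ih => rw [ih, hb k, List.prod_range_succ, mul_assoc]
  have hmem : ∀ k j, (b 0).1 j ∈ bassChain a I k := fun k j => by
    rw [hprod k]
    exact prod_mem_bassChain a I k _
  -- The level `k` is independent of `n`: this uniformity is what stops the chain.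
  have hdiff : ∀ k n, ((List.range n).map a).prod - y.1 ⟨n⟩ ∈ bassChain a I k := by
    intro k n
    induction n with
    | zero =>
      have h := hy 0
      simp only [ConvFam.telescope, ConvFam.point_apply, if_true] at h
      rw [← h]
      simpa using hmem k ⟨0⟩
    | succ n ih =>
      have h := hy (n + 1)
      simp only [ConvFam.telescope, ConvFam.point_apply] at h
      rw [if_neg (by simp), zero_sub, eq_sub_iff_add_eq] at h
      rw [List.prod_range_succ, ← h]
      have h1 := (bassChain a I k).smul_mem (MulOpposite.op (a n)) ih
      rw [op_smul_eq_mul] at h1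
      -- With `P` the product of the first `n` terms, `P aₙ - yₙ₊₁ = (P - yₙ) aₙ + b₀,ₙ₊₁`.
      convert (bassChain a I k).add_mem h1 (hmem k ⟨n + 1⟩) using 1
      noncomm_ring
  have hfin : {n : ℕ | y.1 ⟨n⟩ ∉ I}.Finite :=
    ((ConvFam.tendsto_iff y.1).1 y.2 I hI).preimage ULift.up_injective.injOn
  obtain ⟨M, hM⟩ := hfin.bddAbove
  -- All indices with `yₙ ∉ I` are at most `M`, so `M + 1` is an index where `y` lies in `I`.
  refine ⟨M + 1, fun n hn => le_antisymm (bassChain_antitone a I hn) ?_⟩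
  refine sup_le ?_ le_sup_right
  rw [Submodule.span_singleton_le_iff_mem]
  have hyI : y.1 ⟨M + 1⟩ ∈ I := by
    by_contra h
    exact absurd (hM h) (by simp)
  simpa using (bassChain a I n).add_mem (hdiff n (M + 1)) (Submodule.mem_sup_right hyI)
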